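/- For a homogeneous cubic polynomial $f\in\mathbb{R}[x_1,x_2,x_3]$ let $\Gamma_f=\{[X]\in\mathbb{RP}^2 : f(X)=0\}$ be the cubic curve it defines, let $H_f=(\partial^2 f/\partial x_i\partial x_j)$ be its Hesse matrix, and put $\mathcal{H}(f)=\det H_f$, which is again a cubic form or zero. The $n$-th Hesse derivative of $\Gamma_f$ is the curve $\Gamma_{\mathcal{H}^n(f)}$, where $\mathcal{H}^n$ is the $n$-fold iterate of $\mathcal{H}$. For $c\in\mathbb{R}$ let $f_c=x^3+y^3+z^3+c\,xyz$ and $\Gamma_c=\Gamma_{f_c}$. If the $n$-th Hesse derivative of $\Gamma_c$ equals $\Gamma_c$ for some $n>0$, and $n$ is minimal with this property, then the orbit $\{\Gamma_{\mathcal{H}^k(f_c)} : k\ge 0\}$ is called a Hesse loop of length $n$. Then for every even integer $n>0$ there exists at least one Hesse loop of length $n$. Moreover, for every integer $r\ge 1$ there are at least $$\left\lceil\frac{3^r-5}{2r}\right\rceil+2$$ distinct Hesse loops of length $2r$. -/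

import Mathlib

/-- The projective plane cubic `Γ_f = {[X] ∈ ℝP² ∣ f(X) = 0}` of a homogeneous polynomial `f`. -/
def projCurve (f : MvPolynomial (Fin 3) ℝ) : Set (Projectivization ℝ (Fin 3 → ℝ)) :=
  {P | ∃ (v : Fin 3 → ℝ) (hv : v ≠ 0),
    P = Projectivization.mk ℝ v hv ∧ MvPolynomial.eval v f = 0}

/-- The Hesse matrix `(∂²f / ∂xᵢ∂xⱼ)`. -/
noncomputable def hesseMatrix (f : MvPolynomial (Fin 3) ℝ) :
    Matrix (Fin 3) (Fin 3) (MvPolynomial (Fin 3) ℝ) :=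
  Matrix.of fun i j => MvPolynomial.pderiv i (MvPolynomial.pderiv j f)

/-- The cubic form `det H_f`, which defines the Hesse derivative of the curve of `f`. -/
noncomputable def hesseDet (f : MvPolynomial (Fin 3) ℝ) : MvPolynomial (Fin 3) ℝ :=
  (hesseMatrix f).det

/-- The `n`-th iterated Hesse derivative of `Γ_f`. The iteration is carried out on the defining
forms, since the Hesse derivative of `Γ_f` is by definition `Γ_{det H_f}`. -/
noncomputable def hesseDerivative (n : ℕ) (f : MvPolynomial (Fin 3) ℝ) :
    Set (Projectivization ℝ (Fin 3 → ℝ)) :=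
  projCurve (hesseDet^[n] f)

/-- The Hesse form `x³ + y³ + z³ + c xyz`, the equation of the curve `Γ_c`. -/
noncomputable def hesseForm (c : ℝ) : MvPolynomial (Fin 3) ℝ :=
  MvPolynomial.X 0 ^ 3 + MvPolynomial.X 1 ^ 3 + MvPolynomial.X 2 ^ 3
    + MvPolynomial.C c * (MvPolynomial.X 0 * MvPolynomial.X 1 * MvPolynomial.X 2)

/-- `L` is a Hesse loop of length `n`: for some real `c`, the number `n` is the least positive
integer for which the `n`-th Hesse derivative of `Γ_c` is `Γ_c` again, and `L` is the closed orbit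
of `Γ_c`. A loop is thus a set of curves, and does not depend on the curve it is started from. -/
def IsHesseLoop (n : ℕ) (L : Set (Set (Projectivization ℝ (Fin 3 → ℝ)))) : Prop :=
  ∃ c : ℝ,
    IsLeast {m : ℕ | 0 < m ∧ hesseDerivative m (hesseForm c) = projCurve (hesseForm c)} n ∧
    L = Set.range fun k : ℕ => hesseDerivative k (hesseForm c)

/-! On the Hesse pencil the Hesse derivative acts by `hesseMap`, and the real curve determines `c`.
In the coordinate `x = -3 / c` its square `hesseSq` fixes 0 and 1 and maps three consecutive laps of
`[0, 1]` over the whole interval. Hence any word of length `r` in three letters is the itinerary of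
a point fixed by the `r`-th iterate (`exists_isPeriodicPt_closedLap`); if the word has no short
period, the point has minimal period exactly `r`.

For `x` in `(0, 1)` the parameter `-3 / x` lies below `-3`, while the odd iterates of `hesseMap`
stay above it (`exists_iterate_eq`). So minimal period `r` for `hesseSq` becomes loop length `2 *
r`, and at most `r` of the points found share a loop. Discarding words with a period at most `r / 2`
leaves enough of the `3 ^ r` words for the bound. -/

/-! ### Subintervals stretched end to end -/

open Set Function in
/-- A continuous function crossing `[l, u]` upwards maps some subinterval into `[l, u]`, endpoint
to endpoint. -/
theorem exists_subinterval_mapsTo {F : ℝ → ℝ} {a b l u : ℝ} (hab : a ≤ b)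
    (hF : ContinuousOn F (Icc a b)) (hlu : l ≤ u) (ha : F a ≤ l) (hb : u ≤ F b) :
    ∃ a' b', a ≤ a' ∧ a' ≤ b' ∧ b' ≤ b ∧ F a' = l ∧ F b' = u ∧
      MapsTo F (Icc a' b') (Icc l u) := by
  have hU : IsCompact (Icc a b ∩ F ⁻¹' {u}) :=
    isCompact_Icc.of_isClosed_subset (hF.preimage_isClosed_of_isClosed isClosed_Icc
      isClosed_singleton) inter_subset_left
  obtain ⟨y, hy, hyu⟩ := intermediate_value_Icc hab hF ⟨ha.trans hlu, hb⟩
  -- Take the first point with value `u`, then the last point before it with value `l`; leaving `[l,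
  -- u]` in between would force another crossing.
  obtain ⟨b', ⟨hb', hFb⟩, hmin⟩ := hU.exists_isLeast ⟨y, hy, hyu⟩
  have hF' : ContinuousOn F (Icc a b') := hF.mono (Icc_subset_Icc_right hb'.2)
  have hL : IsCompact (Icc a b' ∩ F ⁻¹' {l}) :=
    isCompact_Icc.of_isClosed_subset (hF'.preimage_isClosed_of_isClosed isClosed_Icc
      isClosed_singleton) inter_subset_left
  have hFb : F b' = u := hFb
  obtain ⟨z, hz, hzl⟩ := intermediate_value_Icc hb'.1 hF' ⟨ha, hlu.trans hFb.ge⟩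
  obtain ⟨a', ⟨ha', hFa⟩, hmax⟩ := hL.exists_isGreatest ⟨z, hz, hzl⟩
  refine ⟨a', b', ha'.1, ha'.2, hb'.2, hFa, hFb, fun x hx => ⟨?_, ?_⟩⟩
  · by_contra! h
    obtain ⟨y, hy, hyl⟩ := intermediate_value_Icc hx.2
      (hF'.mono (Icc_subset_Icc_left (ha'.1.trans hx.1))) ⟨h.le, hlu.trans hFb.ge⟩
    have : y ≤ a' := hmax ⟨⟨ha'.1.trans (hx.1.trans hy.1), hy.2⟩, hyl⟩
    have : x = y := le_antisymm hy.1 (this.trans hx.1)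
    subst this
    linarith
  · by_contra! h
    obtain ⟨y, hy, hyl⟩ := intermediate_value_Icc (ha'.1.trans hx.1)
      (hF'.mono (Icc_subset_Icc_right hx.2)) ⟨ha.trans hlu, h.le⟩
    have : b' ≤ y := hmin ⟨⟨hy.1, hy.2.trans (hx.2.trans hb'.2)⟩, hyl⟩
    have : x = y := le_antisymm (hx.2.trans this) hy.2
    subst this
    linarith

open Set Function in
theorem exists_subinterval_mapsTo' {F : ℝ → ℝ} {a b l u : ℝ} (hab : a ≤ b)
    (hF : ContinuousOn F (Icc a b)) (hlu : l ≤ u) (ha : u ≤ F a) (hb : F b ≤ l) :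
    ∃ a' b', a ≤ a' ∧ a' ≤ b' ∧ b' ≤ b ∧ F a' = u ∧ F b' = l ∧
      MapsTo F (Icc a' b') (Icc l u) := by
  obtain ⟨a', b', h1, h2, h3, h4, h5, h6⟩ := exists_subinterval_mapsTo (F := fun x => -F x)
    hab hF.neg (neg_le_neg hlu) (neg_le_neg ha) (neg_le_neg hb)
  exact ⟨a', b', h1, h2, h3, neg_inj.1 h4, neg_inj.1 h5,
    fun x hx => ⟨neg_le_neg_iff.1 (h6 hx).2, neg_le_neg_iff.1 (h6 hx).1⟩⟩

/-! ### Symbolic dynamics of the triple horseshoe -/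

open Set in
/-- `f` maps each of `[0, p]`, `[p, q]`, `[q, 1]` over `[0, 1]`, going up, down and up. -/
structure IsTripleHorseshoe (f : ℝ → ℝ) (p q : ℝ) : Prop where
  continuousOn : ContinuousOn f (Icc 0 1)
  p_pos : 0 < p
  p_lt_q : p < q
  q_lt_one : q < 1
  map_zero : f 0 = 0
  map_p : f p = 1
  map_q : f q = 0
  map_one : f 1 = 1

/-- The closed laps of a triple horseshoe. -/
def closedLap (p q : ℝ) : Fin 3 → Set ℝ := ![Set.Icc 0 p, Set.Icc p q, Set.Icc q 1]

/-- The open laps of a triple horseshoe. -/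
def openLap (p q : ℝ) : Fin 3 → Set ℝ := ![Set.Ioo 0 p, Set.Ioo p q, Set.Ioo q 1]

namespace IsTripleHorseshoe

open Set Function

variable {f : ℝ → ℝ} {p q : ℝ}

theorem openLap_inj (h : IsTripleHorseshoe f p q) {x : ℝ} {i j : Fin 3}
    (hi : x ∈ openLap p q i) (hj : x ∈ openLap p q j) : i = j := by
  have := h.p_lt_q
  fin_cases i <;> fin_cases j <;> simp [openLap] at hi hj ⊢ <;> linarith

theorem openLap_subset (h : IsTripleHorseshoe f p q) {x : ℝ} {i : Fin 3}
    (hi : x ∈ openLap p q i) : x ∈ Ioo 0 1 ∧ x ≠ q := by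
  have := h.p_pos; have := h.p_lt_q; have := h.q_lt_one
  fin_cases i <;> simp [openLap] at hi ⊢
  · exact ⟨⟨by linarith, by linarith⟩, by intro; linarith⟩
  · exact ⟨⟨by linarith, by linarith⟩, by intro; linarith⟩
  · exact ⟨⟨by linarith, by linarith⟩, by intro; linarith⟩

theorem mem_openLap {x : ℝ} {i : Fin 3} (hi : x ∈ closedLap p q i)
    (h0 : x ≠ 0) (hp : x ≠ p) (hq : x ≠ q) (h1 : x ≠ 1) : x ∈ openLap p q i := by
  fin_cases i <;> simp [closedLap, openLap] at hi ⊢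
  · exact ⟨lt_of_le_of_ne hi.1 h0.symm, lt_of_le_of_ne hi.2 hp⟩
  · exact ⟨lt_of_le_of_ne hi.1 hp.symm, lt_of_le_of_ne hi.2 hq⟩
  · exact ⟨lt_of_le_of_ne hi.1 hq.symm, lt_of_le_of_ne hi.2 h1⟩

theorem exists_subinterval_closedLap (h : IsTripleHorseshoe f p q) (j : Fin 3) {a b : ℝ}
    (ha : 0 ≤ a) (hab : a ≤ b) (hb : b ≤ 1) :
    ∃ a' b', 0 ≤ a' ∧ a' ≤ b' ∧ b' ≤ 1 ∧ (f a' = a ∧ f b' = b ∨ f a' = b ∧ f b' = a) ∧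
      MapsTo f (Icc a' b') (Icc a b) ∧ Icc a' b' ⊆ closedLap p q j := by
  have hp := h.p_pos; have hpq := h.p_lt_q; have hq := h.q_lt_one
  fin_cases j
  · obtain ⟨a', b', h1, h2, h3, h4, h5, h6⟩ := exists_subinterval_mapsTo (F := f) hp.le
      (h.continuousOn.mono (Icc_subset_Icc_right (by linarith))) hab
      (h.map_zero.trans_le ha) (hb.trans h.map_p.ge)
    exact ⟨a', b', by linarith, h2, by linarith, .inl ⟨h4, h5⟩, h6, Icc_subset_Icc h1 h3⟩
  · obtain ⟨a', b', h1, h2, h3, h4, h5, h6⟩ := exists_subinterval_mapsTo' (F := f) hpq.le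
      (h.continuousOn.mono (Icc_subset_Icc (by linarith) (by linarith))) hab
      (hb.trans h.map_p.ge) (h.map_q.trans_le ha)
    exact ⟨a', b', by linarith, h2, by linarith, .inr ⟨h4, h5⟩, h6, Icc_subset_Icc h1 h3⟩
  · obtain ⟨a', b', h1, h2, h3, h4, h5, h6⟩ := exists_subinterval_mapsTo (F := f) hq.le
      (h.continuousOn.mono (Icc_subset_Icc_left (by linarith))) hab
      (h.map_q.trans_le ha) (hb.trans h.map_one.ge)
    exact ⟨a', b', by linarith, h2, by linarith, .inl ⟨h4, h5⟩, h6, Icc_subset_Icc h1 h3⟩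

/-- The word is built from its end: the interval for the shifted word is pulled back into the lap of
the first letter. Keeping track of the endpoints makes the iterate cover `[0, 1]`. -/
theorem exists_interval_itinerary (h : IsTripleHorseshoe f p q) (n : ℕ) (w : ℕ → Fin 3) :
    ∃ a b, 0 ≤ a ∧ a ≤ b ∧ b ≤ 1 ∧ ContinuousOn f^[n] (Icc a b) ∧
      (f^[n] a = 0 ∧ f^[n] b = 1 ∨ f^[n] a = 1 ∧ f^[n] b = 0) ∧
      ∀ i < n, ∀ x ∈ Icc a b, f^[i] x ∈ closedLap p q (w i) := by
  induction n generalizing w with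
  | zero => exact ⟨0, 1, le_rfl, zero_le_one, le_rfl, continuousOn_id, .inl ⟨rfl, rfl⟩, by simp⟩
  | succ n ih =>
    obtain ⟨a, b, ha, hab, hb, hc, he, hi⟩ := ih fun i => w (i + 1)
    obtain ⟨a', b', ha', hab', hb', he', hm, hs⟩ :=
      h.exists_subinterval_closedLap (w 0) ha hab hb
    refine ⟨a', b', ha', hab', hb', ?_, ?_, ?_⟩
    · rw [iterate_succ]
      exact hc.comp (h.continuousOn.mono (Icc_subset_Icc ha' hb')) hm
    · simp only [iterate_succ_apply]
      rcases he' with ⟨e1, e2⟩ | ⟨e1, e2⟩ <;> rw [e1, e2] <;> tauto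
    · rintro (_ | i) hin x hx
      · exact hs hx
      · rw [iterate_succ_apply]
        exact hi i (by omega) _ (hm hx)

/-- On the itinerary interval the iterate takes the values 0 and 1 at the ends, so its graph meets
the diagonal there. -/
theorem exists_isPeriodicPt_closedLap (h : IsTripleHorseshoe f p q) (n : ℕ) (w : ℕ → Fin 3) :
    ∃ x, IsPeriodicPt f n x ∧ ∀ i < n, f^[i] x ∈ closedLap p q (w i) := by
  obtain ⟨a, b, ha, hab, hb, hc, he, hi⟩ := h.exists_interval_itinerary n w
  have : (0 : ℝ) ∈ (fun x => f^[n] x - x) '' Icc a b := by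
    rcases he with ⟨e1, e2⟩ | ⟨e1, e2⟩
    · exact intermediate_value_Icc hab (hc.sub continuousOn_id)
        ⟨by simp [e1, ha], by simp [e2, hb]⟩
    · exact intermediate_value_Icc' hab (hc.sub continuousOn_id)
        ⟨by simp [e2]; linarith, by simp [e1]; linarith⟩
  obtain ⟨x, hx, hx0⟩ := this
  exact ⟨x, sub_eq_zero.1 hx0, fun i hin => hi i hin x hx⟩

theorem eq_of_isPeriodicPt_of_iterate_eq {α : Type*} {g : α → α} {x e : α} {n i : ℕ}
    (hn : 0 < n) (hx : IsPeriodicPt g n x) (he : IsFixedPt g e) (hi : g^[i] x = e) : x = e := by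
  have h1 : g^[n * i] x = x := (hx.mul_const i)
  obtain ⟨k, hk⟩ := Nat.exists_eq_add_of_le (Nat.le_mul_of_pos_left i hn)
  rw [hk, add_comm, iterate_add_apply, hi, (he.iterate k)] at h1
  exact h1.symm

/-- Every word other than the two constant ones that belong to the fixed endpoints is the
itinerary of a periodic point. -/
theorem exists_isPeriodicPt_openLap (h : IsTripleHorseshoe f p q) {n : ℕ} (hn : 0 < n)
    (w : Fin n → Fin 3) (h0 : ∃ i, w i ≠ 0) (h2 : ∃ i, w i ≠ 2) :
    ∃ x, IsPeriodicPt f n x ∧ ∀ i : Fin n, f^[i] x ∈ openLap p q (w i) := by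
  have hp := h.p_pos; have hpq := h.p_lt_q; have hq := h.q_lt_one
  obtain ⟨x, hx, hi⟩ := h.exists_isPeriodicPt_closedLap n
    fun i => if hi : i < n then w ⟨i, hi⟩ else 0
  replace hi (i : Fin n) : f^[i] x ∈ closedLap p q (w i) := by simpa using hi i i.2
  have fix0 : IsFixedPt f 0 := h.map_zero
  have fix1 : IsFixedPt f 1 := h.map_one
  have x0 : x ≠ 0 := by
    rintro rfl
    obtain ⟨i, hne⟩ := h0
    have := hi i
    rw [fix0.iterate] at this
    generalize w i = j at *
    fin_cases j <;> simp [closedLap] at this hne <;> linarith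
  have x1 : x ≠ 1 := by
    rintro rfl
    obtain ⟨i, hne⟩ := h2
    have := hi i
    rw [fix1.iterate] at this
    generalize w i = j at *
    fin_cases j <;> simp [closedLap] at this hne <;> linarith
  have ne0 (i : ℕ) : f^[i] x ≠ 0 := fun e => x0 (eq_of_isPeriodicPt_of_iterate_eq hn hx fix0 e)
  have ne1 (i : ℕ) : f^[i] x ≠ 1 := fun e => x1 (eq_of_isPeriodicPt_of_iterate_eq hn hx fix1 e)
  -- The breakpoints `p` and `q` map to the fixed points 1 and 0, which the orbit avoids.
  refine ⟨x, hx, fun i => mem_openLap (hi i) (ne0 i) (fun e => ?_) (fun e => ?_) (ne1 i)⟩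
  · exact ne1 (i + 1) (by rw [iterate_succ_apply', e, h.map_p])
  · exact ne0 (i + 1) (by rw [iterate_succ_apply', e, h.map_q])

/-- A word without a proper period is the itinerary of a point whose minimal period is the
length of the word. -/
theorem exists_minimalPeriod_eq (h : IsTripleHorseshoe f p q) {n : ℕ} (hn : 0 < n)
    (w : Fin n → Fin 3) (h0 : ∃ i, w i ≠ 0) (h2 : ∃ i, w i ≠ 2)
    (hw : ∀ d, 0 < d → d ≤ n / 2 → ∃ i j : Fin n, (j : ℕ) = i + d ∧ w i ≠ w j) :
    ∃ x, minimalPeriod f x = n ∧ ∀ i : Fin n, f^[i] x ∈ openLap p q (w i) := by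
  obtain ⟨x, hx, hi⟩ := h.exists_isPeriodicPt_openLap hn w h0 h2
  refine ⟨x, ?_, hi⟩
  by_contra hne
  obtain ⟨k, hk⟩ := hx.minimalPeriod_dvd
  have hd : 0 < minimalPeriod f x := hx.minimalPeriod_pos hn
  have hk2 : 2 ≤ k := by
    rcases k with _ | _ | k
    · omega
    · omega
    · omega
  -- A proper divisor of `n` is at most `n / 2`, so `hw` excludes it as a period.
  obtain ⟨i, j, hij, hwij⟩ := hw _ hd ((Nat.le_div_iff_mul_le two_pos).2 (by nlinarith))
  refine hwij (h.openLap_inj (hi i) ?_)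
  have := hi j
  rwa [hij, iterate_add_apply, iterate_minimalPeriod] at this

end IsTripleHorseshoe

/-! ### Counting words without short periods -/

open Classical in
/-- A lower bound for the number of words of length `n` without a period `d ≤ n / 2`. -/
theorem card_filter_forall_exists_shift_ne (n : ℕ) :
    3 ^ n ≤ (Finset.univ.filter fun w : Fin n → Fin 3 =>
        ∀ d, 0 < d → d ≤ n / 2 → ∃ i j : Fin n, (j : ℕ) = i + d ∧ w i ≠ w j).card
      + ∑ d ∈ Finset.Icc 1 (n / 2), 3 ^ d := by
  set good := Finset.univ.filter fun w : Fin n → Fin 3 =>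
        ∀ d, 0 < d → d ≤ n / 2 → ∃ i j : Fin n, (j : ℕ) = i + d ∧ w i ≠ w j with hgood
  let bad (d : ℕ) := Finset.univ.filter fun w : Fin n → Fin 3 =>
        ∀ i j : Fin n, (j : ℕ) = i + d → w i = w j
  have hbad : ∀ d ∈ Finset.Icc 1 (n / 2), (bad d).card ≤ 3 ^ d := by
    intro d hd
    rw [Finset.mem_Icc] at hd
    have hdn : d ≤ n := hd.2.trans (Nat.div_le_self _ _)
    have : (Finset.univ : Finset (Fin d → Fin 3)).card = 3 ^ d := by simp
    rw [← this]
    -- A word with period `d` is determined by its first `d` letters.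
    refine Finset.card_le_card_of_injOn (fun w i => w (Fin.castLE hdn i)) (by simp) ?_
    intro w hw w' hw' hww
    have hw : ∀ i j : Fin n, (j : ℕ) = i + d → w i = w j := by simpa [bad] using hw
    have hw' : ∀ i j : Fin n, (j : ℕ) = i + d → w' i = w' j := by simpa [bad] using hw'
    have key : ∀ k (hk : k < n), w ⟨k, hk⟩ = w' ⟨k, hk⟩ := by
      intro k
      induction k using Nat.strong_induction_on with
      | _ k ih =>
        intro hk
        by_cases hkd : k < d
        · exact congrFun hww ⟨k, hkd⟩
        · have hlt : k - d < n := by omega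
          rw [← hw ⟨k - d, hlt⟩ ⟨k, hk⟩ (by simp; omega),
            ← hw' ⟨k - d, hlt⟩ ⟨k, hk⟩ (by simp; omega)]
          exact ih _ (by omega) _
    funext i
    exact key i i.2
  have hcover : (Finset.univ : Finset (Fin n → Fin 3)) ⊆
      good ∪ (Finset.Icc 1 (n / 2)).biUnion bad := by
    intro w _
    rw [Finset.mem_union]
    by_cases hw : w ∈ good
    · exact .inl hw
    · right
      simp only [hgood, Finset.mem_filter, Finset.mem_univ, true_and] at hw
      push Not at hw
      obtain ⟨d, h1, h2, h3⟩ := hw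
      exact Finset.mem_biUnion.2 ⟨d, Finset.mem_Icc.2 ⟨h1, h2⟩, by simpa [bad] using h3⟩
  calc 3 ^ n = (Finset.univ : Finset (Fin n → Fin 3)).card := by simp
    _ ≤ _ := Finset.card_le_card hcover
    _ ≤ _ := Finset.card_union_le _ _
    _ ≤ _ := by gcongr; exact Finset.card_biUnion_le.trans (Finset.sum_le_sum hbad)

/-! ### The Hesse derivative on the Hesse pencil -/

/-- The Hesse pencil in homogeneous parameters. -/
noncomputable def hessePencil (a b : ℝ) : MvPolynomial (Fin 3) ℝ :=
  MvPolynomial.C a * (MvPolynomial.X 0 ^ 3 + MvPolynomial.X 1 ^ 3 + MvPolynomial.X 2 ^ 3)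
    + MvPolynomial.C b * (MvPolynomial.X 0 * MvPolynomial.X 1 * MvPolynomial.X 2)

theorem hessePencil_one (c : ℝ) : hessePencil 1 c = hesseForm c := by
  simp [hessePencil, hesseForm]

/-- The pencil is closed under the Hessian determinant. Two parameters carry the scalar factor that
iteration on forms accumulates; only the ratio `b / a` matters for the curve. -/
theorem hesseDet_hessePencil (a b : ℝ) :
    hesseDet (hessePencil a b) = hessePencil (-6 * a * b ^ 2) (216 * a ^ 3 + 2 * b ^ 3) := by
  have h01 : (1 : Fin 3) ≠ 0 := by decide
  have h02 : (2 : Fin 3) ≠ 0 := by decide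
  have h12 : (2 : Fin 3) ≠ 1 := by decide
  simp only [hesseDet, hesseMatrix, hessePencil, Matrix.det_fin_three, Matrix.of_apply,
    map_add, Derivation.leibniz, Derivation.leibniz_pow, MvPolynomial.pderiv_C,
    MvPolynomial.pderiv_X_self, MvPolynomial.pderiv_X_of_ne h01, MvPolynomial.pderiv_X_of_ne h02,
    MvPolynomial.pderiv_X_of_ne h12, MvPolynomial.pderiv_X_of_ne h01.symm,
    MvPolynomial.pderiv_X_of_ne h02.symm, MvPolynomial.pderiv_X_of_ne h12.symm,
    smul_eq_mul, nsmul_eq_mul, map_mul, map_pow, map_neg, map_zero,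
    Derivation.map_natCast, Derivation.map_one_eq_zero, mul_zero, zero_mul, add_zero, zero_add]
  simp
  have e6 : (MvPolynomial.C (6 : ℝ) : MvPolynomial (Fin 3) ℝ) = 6 := rfl
  have e216 : (MvPolynomial.C (216 : ℝ) : MvPolynomial (Fin 3) ℝ) = 216 := rfl
  have e2 : (MvPolynomial.C (2 : ℝ) : MvPolynomial (Fin 3) ℝ) = 2 := rfl
  rw [e6, e216, e2]
  ring

theorem projCurve_hessePencil {a : ℝ} (ha : a ≠ 0) (b : ℝ) :
    projCurve (hessePencil a b) = projCurve (hesseForm (b / a)) := by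
  have key (v : Fin 3 → ℝ) : MvPolynomial.eval v (hessePencil a b) =
      a * MvPolynomial.eval v (hesseForm (b / a)) := by
    simp [hessePencil, hesseForm]
    field_simp
  simp [projCurve, key, ha]

/-- The parameter of a Hesse form is determined by its real curve. -/
theorem projCurve_hesseForm_injective :
    Function.Injective fun c : ℝ => projCurve (hesseForm c) := by
  intro c c' h
  -- This says that `[1 : 1 : z]` lies on the curve; since `z ≠ 0`, the equation can be solved for
  -- `c`.
  obtain ⟨z, hz⟩ : ∃ z : ℝ, z ^ 3 + c * z + 2 = 0 := by
    have hc : Continuous fun z : ℝ => z ^ 3 + c * z + 2 := by fun_prop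
    refine mem_range_of_exists_le_of_exists_ge hc ⟨-(2 + |c|), ?_⟩ ⟨2 + |c|, ?_⟩
    · nlinarith [abs_nonneg c, neg_abs_le c, le_abs_self c, sq_nonneg (|c|),
        mul_nonneg (abs_nonneg c) (sq_nonneg (|c|)),
        mul_nonneg (abs_nonneg c) (sub_nonneg.2 (neg_abs_le c)),
        mul_nonneg (abs_nonneg c) (neg_le_iff_add_nonneg.1 (neg_abs_le c))]
    · nlinarith [abs_nonneg c, neg_abs_le c, le_abs_self c, sq_nonneg (|c|),
        mul_nonneg (abs_nonneg c) (sq_nonneg (|c|)),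
        mul_nonneg (abs_nonneg c) (neg_le_iff_add_nonneg.1 (neg_abs_le c))]
  have hz0 : z ≠ 0 := by rintro rfl; norm_num at hz
  have hv : (![1, 1, z] : Fin 3 → ℝ) ≠ 0 := fun e => by simpa using congrFun e 0
  have hmem : Projectivization.mk ℝ _ hv ∈ projCurve (hesseForm c) :=
    ⟨_, hv, rfl, by simp [hesseForm]; linarith⟩
  have h : projCurve (hesseForm c) = projCurve (hesseForm c') := h
  rw [h] at hmem
  obtain ⟨v, hv', he, h0⟩ := hmem
  obtain ⟨t, ht⟩ := (Projectivization.mk_eq_mk_iff' ℝ _ _ hv hv').1 he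
  have e0 : t * v 0 = 1 := by simpa using congrFun ht 0
  have e1 : t * v 1 = 1 := by simpa using congrFun ht 1
  have e2 : t * v 2 = z := by simpa using congrFun ht 2
  have h0' : v 0 ^ 3 + v 1 ^ 3 + v 2 ^ 3 + c' * (v 0 * v 1 * v 2) = 0 := by
    simpa [hesseForm] using h0
  have : (t * v 0) ^ 3 + (t * v 1) ^ 3 + (t * v 2) ^ 3
      + c' * ((t * v 0) * (t * v 1) * (t * v 2)) = 0 := by
    linear_combination t ^ 3 * h0'
  rw [e0, e1, e2] at this
  exact mul_right_cancel₀ hz0 (by linarith)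

/-- The action of the Hesse derivative on the parameter of a Hesse form. -/
noncomputable def hesseMap (c : ℝ) : ℝ := -(108 + c ^ 3) / (3 * c ^ 2)

/-- A zero parameter would send the next form out of the chart `a ≠ 0`, where `hesseMap` no longer
describes it. -/
theorem exists_iterate_hesseDet_eq {c : ℝ} (hc : ∀ k, hesseMap^[k] c ≠ 0) (k : ℕ) :
    ∃ a b, a ≠ 0 ∧ b / a = hesseMap^[k] c ∧ hesseDet^[k] (hesseForm c) = hessePencil a b := by
  induction k with
  | zero => exact ⟨1, c, one_ne_zero, div_one c, (hessePencil_one c).symm⟩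
  | succ k ih =>
    obtain ⟨a, b, ha, hab, hk⟩ := ih
    have hb : b ≠ 0 := by
      rintro rfl
      exact hc k (by rw [← hab, zero_div])
    refine ⟨_, _, ?_, ?_, by rw [Function.iterate_succ_apply', hk, hesseDet_hessePencil]⟩
    · simp [ha, hb]
    · rw [Function.iterate_succ_apply', ← hab, hesseMap]
      field_simp
      ring

theorem hesseDerivative_hesseForm {c : ℝ} (hc : ∀ k, hesseMap^[k] c ≠ 0) (k : ℕ) :
    hesseDerivative k (hesseForm c) = projCurve (hesseForm (hesseMap^[k] c)) := by
  obtain ⟨a, b, ha, hab, hk⟩ := exists_iterate_hesseDet_eq hc k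
  rw [hesseDerivative, hk, projCurve_hessePencil ha, hab]

/-! ### The squared Hesse map as a triple horseshoe -/

/-- The square of `hesseMap` in the coordinate `x = -3 / c`. -/
noncomputable def hesseSq (x : ℝ) : ℝ :=
  9 * x * (1 - 4 * x ^ 3) ^ 2 / ((1 - 4 * x ^ 3) ^ 3 + 108 * x ^ 3)

theorem hesseSq_denom_pos {x : ℝ} (h0 : 0 ≤ x) (h1 : x ≤ 1) :
    0 < (1 - 4 * x ^ 3) ^ 3 + 108 * x ^ 3 := by
  have h3 : 0 ≤ x ^ 3 := by positivity
  have h3' : x ^ 3 ≤ 1 := pow_le_one₀ h0 h1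
  generalize x ^ 3 = u at *
  nlinarith [mul_nonneg h3 (sub_nonneg.2 h3'), mul_nonneg (mul_nonneg h3 h3) (sub_nonneg.2 h3')]

theorem exists_isTripleHorseshoe_hesseSq :
    ∃ p q, IsTripleHorseshoe hesseSq p q ∧ ∀ x, 4 * x ^ 3 = 1 → x = q := by
  have hcont : Continuous fun x : ℝ => 4 * x ^ 3 + 6 * x := by fun_prop
  have hcont' : Continuous fun x : ℝ => 4 * x ^ 3 := by fun_prop
  obtain ⟨p, ⟨hp0, hp1⟩, hp : 4 * p ^ 3 + 6 * p = 1⟩ :=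
    intermediate_value_Icc (zero_le_one' ℝ) hcont.continuousOn
      (show (1 : ℝ) ∈ _ by norm_num)
  obtain ⟨q, ⟨hq0, hq1⟩, hq : 4 * q ^ 3 = 1⟩ :=
    intermediate_value_Icc (zero_le_one' ℝ) hcont'.continuousOn
      (show (1 : ℝ) ∈ _ by norm_num)
  have hp0 : 0 < p := lt_of_le_of_ne hp0 (by rintro rfl; norm_num at hp)
  refine ⟨p, q, ⟨?_, hp0, ?_, ?_, ?_, ?_, ?_, ?_⟩, ?_⟩
  · exact ContinuousOn.div (by fun_prop) (by fun_prop)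
      fun x hx => (hesseSq_denom_pos hx.1 hx.2).ne'
  · exact lt_of_pow_lt_pow_left₀ 3 hq0 (by linarith)
  · exact lt_of_le_of_ne hq1 (by rintro rfl; norm_num at hq)
  · simp [hesseSq]
  · rw [hesseSq, div_eq_one_iff_eq (hesseSq_denom_pos hp0.le hp1).ne']
    -- Numerator minus denominator of `hesseSq x` is `-(1 - x) * (1 + 2 * x) ^ 2 * (4 * x ^ 3 + 6 *
    -- x - 1) ^ 2`, which explains the choice of `p`.
    linear_combination (1 - p) * (1 + 2 * p) ^ 2 * (4 * p ^ 3 + 6 * p - 1) * (-hp)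
  · simp [hesseSq, hq]
  · norm_num [hesseSq]
  · intro x hx
    exact (Odd.strictMono_pow (R := ℝ) (n := 3) (by decide)).injective
      (by linarith : x ^ 3 = q ^ 3)

theorem hesseMap_neg_three_div {x : ℝ} (hx : x ≠ 0) :
    hesseMap (-3 / x) = (1 - 4 * x ^ 3) / x := by
  rw [hesseMap]
  field_simp
  ring

theorem hesseMap_hesseMap_neg_three_div {x : ℝ} (hx : x ∈ Set.Ioo 0 1) (hq : 4 * x ^ 3 ≠ 1) :
    hesseMap (hesseMap (-3 / x)) = -3 / hesseSq x := by
  have h0 := hx.1.ne'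
  have h1 : 1 - 4 * x ^ 3 ≠ 0 := sub_ne_zero.2 hq.symm
  have h2 := (hesseSq_denom_pos hx.1.le hx.2.le).ne'
  rw [hesseMap_neg_three_div h0, hesseMap, hesseSq]
  field_simp
  ring

/-- The orbit of `x` under `hesseSq` stays in `(0, 1)` and away from the zero of `hesseSq`. -/
def IsRegularOrbit (x : ℝ) : Prop :=
  ∀ k, hesseSq^[k] x ∈ Set.Ioo 0 1 ∧ 4 * (hesseSq^[k] x) ^ 3 ≠ 1

namespace IsRegularOrbit

open Function

variable {x y : ℝ} {r : ℕ}

theorem iterate_two_mul (hx : IsRegularOrbit x) (k : ℕ) :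
    hesseMap^[2 * k] (-3 / x) = -3 / hesseSq^[k] x := by
  induction k with
  | zero => rfl
  | succ k ih =>
    rw [mul_add, mul_one, add_comm, iterate_add_apply, ih, iterate_succ_apply' hesseSq,
      ← hesseMap_hesseMap_neg_three_div (hx k).1 (hx k).2]
    rfl

theorem iterate_two_mul_add_one (hx : IsRegularOrbit x) (k : ℕ) :
    hesseMap^[2 * k + 1] (-3 / x) = (1 - 4 * (hesseSq^[k] x) ^ 3) / hesseSq^[k] x := by
  rw [iterate_succ_apply', hx.iterate_two_mul, hesseMap_neg_three_div (hx k).1.1.ne']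

theorem iterate_ne_zero (hx : IsRegularOrbit x) (k : ℕ) : hesseMap^[k] (-3 / x) ≠ 0 := by
  obtain ⟨k, rfl | rfl⟩ := k.even_or_odd'
  · rw [hx.iterate_two_mul]
    exact div_ne_zero (by norm_num) (hx k).1.1.ne'
  · rw [hx.iterate_two_mul_add_one]
    exact div_ne_zero (sub_ne_zero.2 (hx k).2.symm) (hx k).1.1.ne'

/-- The odd iterates are greater than `-3`, so only the even ones can be less than `-3`. -/
theorem exists_iterate_eq (hx : IsRegularOrbit x) (hy : IsRegularOrbit y) {m : ℕ}
    (h : hesseMap^[m] (-3 / x) = -3 / y) : ∃ k, m = 2 * k ∧ hesseSq^[k] x = y := by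
  have hy0 : y ∈ Set.Ioo 0 1 := (hy 0).1
  obtain ⟨k, rfl | rfl⟩ := m.even_or_odd'
  · rw [hx.iterate_two_mul, div_eq_div_iff (hx k).1.1.ne' hy0.1.ne'] at h
    exact ⟨k, rfl, by linarith⟩
  · rw [hx.iterate_two_mul_add_one] at h
    obtain ⟨h0, h1⟩ := (hx k).1
    generalize hesseSq^[k] x = u at *
    have hl : -3 / y < -3 := by rw [div_lt_iff₀ hy0.1]; linarith [hy0.2]
    have hu : -3 < (1 - 4 * u ^ 3) / u := by
      rw [lt_div_iff₀ h0]
      -- The claim is `0 < 1 + 3 * u - 4 * u ^ 3`, which factors as `(1 - u) * (1 + 2 * u) ^ 2`.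
      nlinarith [mul_pos (sub_pos.2 h1) (show 0 < (1 + 2 * u) ^ 2 by positivity)]
    linarith

theorem isHesseLoop (hx : IsRegularOrbit x) (hr : 0 < r) (hmin : minimalPeriod hesseSq x = r) :
    IsHesseLoop (2 * r) (Set.range fun k : ℕ => hesseDerivative k (hesseForm (-3 / x))) := by
  refine ⟨-3 / x, ⟨⟨by omega, ?_⟩, ?_⟩, rfl⟩
  · rw [hesseDerivative_hesseForm hx.iterate_ne_zero, hx.iterate_two_mul, ← hmin,
      iterate_minimalPeriod]
  · rintro m ⟨hm, he⟩
    rw [hesseDerivative_hesseForm hx.iterate_ne_zero] at he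
    obtain ⟨k, rfl, hk⟩ := hx.exists_iterate_eq hx (projCurve_hesseForm_injective he)
    have := IsPeriodicPt.minimalPeriod_le (by omega : 0 < k) hk
    omega

theorem mem_iterates_of_range_eq (hx : IsRegularOrbit x) (hy : IsRegularOrbit y) (hr : 0 < r)
    (hmin : minimalPeriod hesseSq x = r)
    (h : (Set.range fun k : ℕ => hesseDerivative k (hesseForm (-3 / y))) =
      Set.range fun k : ℕ => hesseDerivative k (hesseForm (-3 / x))) :
    y ∈ (Finset.range r).image fun k => hesseSq^[k] x := by
  obtain ⟨m, hm⟩ := h.subset ⟨0, rfl⟩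
  simp only [hesseDerivative_hesseForm hx.iterate_ne_zero,
    hesseDerivative_hesseForm hy.iterate_ne_zero] at hm
  obtain ⟨k, -, hk⟩ := hx.exists_iterate_eq hy (projCurve_hesseForm_injective hm)
  refine Finset.mem_image.2 ⟨k % r, Finset.mem_range.2 (Nat.mod_lt _ hr), ?_⟩
  rw [← hk, ← hmin, iterate_mod_minimalPeriod_eq]

end IsRegularOrbit

/-! ### From words to the number of loops -/

-- Distinct words give distinct points, and the points whose loop is a given one lie in a single
-- `hesseSq`-orbit of at most `r` points; so each loop arises from at most `r` words.
open Classical in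
theorem exists_finset_isHesseLoop {r : ℕ} (hr : 0 < r) (W : Finset (Fin r → Fin 3))
    (h0 : ∀ w ∈ W, ∃ i, w i ≠ 0) (h2 : ∀ w ∈ W, ∃ i, w i ≠ 2)
    (hW : ∀ w ∈ W, ∀ d, 0 < d → d ≤ r / 2 → ∃ i j : Fin r, (j : ℕ) = i + d ∧ w i ≠ w j) :
    ∃ S : Finset (Set (Set (Projectivization ℝ (Fin 3 → ℝ)))),
      (∀ L ∈ S, IsHesseLoop (2 * r) L) ∧ W.card ≤ r * S.card := by
  obtain ⟨p, q, h, hq⟩ := exists_isTripleHorseshoe_hesseSq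
  choose! x hx hxw using fun w hw =>
    h.exists_minimalPeriod_eq hr w (h0 w hw) (h2 w hw) (hW w hw)
  have hreg : ∀ w ∈ W, IsRegularOrbit (x w) := by
    intro w hw k
    have := hxw w hw ⟨k % r, Nat.mod_lt _ hr⟩
    simp only [← hx w hw, Function.iterate_mod_minimalPeriod_eq] at this
    exact ⟨(h.openLap_subset this).1, fun e => (h.openLap_subset this).2 (hq _ e)⟩
  have hinj : Set.InjOn x W := fun w hw w' hw' e => funext fun i =>
    h.openLap_inj (hxw w hw i) (e ▸ hxw w' hw' i)
  refine ⟨W.image fun w => Set.range fun k : ℕ => hesseDerivative k (hesseForm (-3 / x w)),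
    ?_, Finset.card_le_mul_card_image _ _ ?_⟩
  · simp only [Finset.mem_image]
    rintro _ ⟨w, hw, rfl⟩
    exact (hreg w hw).isHesseLoop hr (hx w hw)
  · simp only [Finset.mem_image]
    rintro _ ⟨w, hw, rfl⟩
    calc _ ≤ ((Finset.range r).image fun k => hesseSq^[k] (x w)).card := by
          refine Finset.card_le_card_of_injOn x (fun w' hw' => ?_)
            (hinj.mono fun w' hw' => (Finset.mem_filter.1 hw').1)
          obtain ⟨hw', he⟩ := Finset.mem_filter.1 hw'
          exact (hreg w hw).mem_iterates_of_range_eq (hreg w' hw') hr (hx w hw) he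
      _ ≤ (Finset.range r).card := Finset.card_image_le
      _ = r := Finset.card_range r

theorem two_mul_sum_Icc_three_pow (m : ℕ) :
    2 * ∑ d ∈ Finset.Icc 1 m, 3 ^ d + 3 = 3 * 3 ^ m := by
  induction m with
  | zero => rfl
  | succ m ih =>
    rw [Finset.sum_Icc_succ_top (by omega), pow_succ]
    omega

/-- This is the slack needed to absorb the discarded words. Induction goes in steps of two because
of `r / 2`; equality holds at `r = 2`. -/
theorem three_mul_three_pow_half_add_le {r : ℕ} (hr : 1 ≤ r) :
    3 * 3 ^ (r / 2) + 4 * r ≤ 3 ^ r + 8 := by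
  induction r using Nat.strong_induction_on with
  | _ r ih =>
    rcases (by omega : r = 1 ∨ r = 2 ∨ 3 ≤ r) with rfl | rfl | h
    · norm_num
    · norm_num
    · have := ih (r - 2) (by omega) (by omega)
      obtain ⟨s, rfl⟩ : ∃ s, r = s + 2 := ⟨r - 2, by omega⟩
      rw [Nat.add_sub_cancel] at this
      rw [show (s + 2) / 2 = s / 2 + 1 by omega, pow_succ, pow_add]
      have : 3 ^ 1 ≤ 3 ^ s := Nat.pow_le_pow_right (by norm_num) (by omega)
      omega

/-- The inequality is the required bound with ceiling and denominator cleared. -/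
theorem exists_finset_isHesseLoop_three_pow_le {r : ℕ} (hr : 1 ≤ r) :
    ∃ S : Finset (Set (Set (Projectivization ℝ (Fin 3 → ℝ)))),
      (∀ L ∈ S, IsHesseLoop (2 * r) L) ∧ 3 ^ r + 4 * r ≤ 2 * (r * S.card) + 5 := by
  classical
  obtain rfl | hr2 := hr.eq_or_lt
  -- For `r = 1` the period condition is vacuous and does not exclude the words 0 and 2 of the fixed
  -- endpoints; the single word 1 already suffices, with equality.
  · obtain ⟨S, hS, hc⟩ := exists_finset_isHesseLoop one_pos {fun _ => 1}
      (by simp) (by simp) (by intro w _ d h1 h2; omega)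
    exact ⟨S, hS, by rw [Finset.card_singleton] at hc; omega⟩
  · have hcard := card_filter_forall_exists_shift_ne r
    set W := Finset.univ.filter fun w : Fin r → Fin 3 =>
      ∀ d, 0 < d → d ≤ r / 2 → ∃ i j : Fin r, (j : ℕ) = i + d ∧ w i ≠ w j with hWdef
    have hW : ∀ w ∈ W, ∀ d, 0 < d → d ≤ r / 2 →
        ∃ i j : Fin r, (j : ℕ) = i + d ∧ w i ≠ w j := fun w hw => (Finset.mem_filter.1 hw).2
    have hne (a : Fin 3) : ∀ w ∈ W, ∃ i, w i ≠ a := by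
      intro w hw
      -- As `r ≥ 2`, the shift `d = 1` is admissible and rules out constant words.
      obtain ⟨i, j, -, hij⟩ := hW w hw 1 one_pos (by omega)
      by_contra! hall
      exact hij ((hall i).trans (hall j).symm)
    obtain ⟨S, hS, hc⟩ := exists_finset_isHesseLoop hr W (hne 0) (hne 2) hW
    refine ⟨S, hS, ?_⟩
    have h1 := two_mul_sum_Icc_three_pow (r / 2)
    have h2 := three_mul_three_pow_half_add_le hr
    have h3 : 3 ^ r ≤ W.card + ∑ d ∈ Finset.Icc 1 (r / 2), 3 ^ d := by convert hcard
    omega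

theorem ceil_three_pow_sub_five_div_le {r n : ℕ} (hr : 1 ≤ r)
    (h : 3 ^ r + 4 * r ≤ 2 * (r * n) + 5) :
    ⌈((3 : ℚ) ^ r - 5) / (2 * (r : ℚ))⌉ + 2 ≤ (n : ℤ) := by
  have hr' : (0 : ℚ) < 2 * r := by positivity
  have h' : (3 : ℚ) ^ r + 4 * r ≤ 2 * (r * n) + 5 := by exact_mod_cast h
  rw [← le_sub_iff_add_le, Int.ceil_le, div_le_iff₀ hr']
  push_cast
  linarith

theorem mainTheorem8 :
    (∀ n : ℕ, 0 < n → Even n →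
      ∃ L : Set (Set (Projectivization ℝ (Fin 3 → ℝ))), IsHesseLoop n L) ∧
    (∀ r : ℕ, 1 ≤ r →
      ∃ S : Finset (Set (Set (Projectivization ℝ (Fin 3 → ℝ)))),
        (∀ L ∈ S, IsHesseLoop (2 * r) L) ∧
        ⌈((3 : ℚ) ^ r - 5) / (2 * (r : ℚ))⌉ + 2 ≤ (S.card : ℤ)) := by
  constructor
  · rintro n hn ⟨r, rfl⟩
    have hr : 1 ≤ r := by omega
    obtain ⟨S, hS, hc⟩ := exists_finset_isHesseLoop_three_pow_le hr
    have hne : S.Nonempty := by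
      rw [Finset.nonempty_iff_ne_empty]
      rintro rfl
      have : 3 ^ 1 ≤ 3 ^ r := Nat.pow_le_pow_right (by norm_num) hr
      simp at hc
      omega
    obtain ⟨L, hL⟩ := hne
    exact ⟨L, two_mul r ▸ hS L hL⟩
  · intro r hr
    obtain ⟨S, hS, hc⟩ := exists_finset_isHesseLoop_three_pow_le hr
    exact ⟨S, hS, ceil_three_pow_sub_five_div_le hr hc⟩
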